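/- All matroids are finite. For a matroid $M$ on $S$ with rank function $\rho_M$, put $\nu_M(A)=|A|-\rho_M(A)$ and $\lambda_M(A)=\rho_M(S)-\rho_M(A)$ for $A\subseteq S$; the rank and nullity of $M$ are $\rho_M(S)$ and $\nu_M(S)$. For matroids $M$ on $S$ and $N$ on $T$, with $S\cap T=\emptyset$, the free product $M\mathbin{\Box}N$ is the matroid on $S\cup T$ whose independent sets are the sets $A\subseteq S\cup T$ such that $A\cap S$ is independent in $M$ and $\lambda_M(A\cap S)\ge\nu_N(A\cap T)$. A matroid $M$ is irreducible if its ground set is nonempty and every factorization $M=P\mathbin{\Box}Q$ has $P=M$ or $Q=M$. For $n\ge 0$ let $m_n$ and $i_n$ be the numbers of isomorphism classes of matroids and of irreducible matroids, respectively, on $n$ elements, and for $r,k\ge 0$ let $m_{r,k}$ and $i_{r,k}$ be the numbers of isomorphism classes of matroids and of irreducible matroids, respectively, of rank $r$ and nullity $k$. Let $$M(t)=\sum_{n\ge0}m_nt^n,\quad I(t)=\sum_{n\ge0}i_nt^n,\quad M(x,y)=\sum_{r,k\ge0}m_{r,k}x^ry^k,\quad I(x,y)=\sum_{r,k\ge0}i_{r,k}x^ry^k.$$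 Then, as formal power series with rational coefficients, $1-I(t)$ and $1-I(x,y)$ are invertible and $$M(t)=\frac{1}{1-I(t)}\qquad\text{and}\qquad M(x,y)=\frac{1}{1-I(x,y)}.$$ -/

import Mathlib

namespace FreeProd

universe u v w

variable {α : Type u} {β : Type v} {γ : Type w}

/-- The rank `ρ_M(A)` of a set in a finite matroid, as a natural number. -/
noncomputable def rk (M : Matroid α) (A : Set α) : ℕ := (M.eRk A).toNat

/-- The nullity `ν_M(A) = |A| - ρ_M(A)` of a set `A ⊆ M.E` in a finite matroid. -/
noncomputable def nullity (M : Matroid α) (A : Set α) : ℕ := A.ncard - rk M A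

/-- The rank-lack `λ_M(A) = ρ(M) - ρ_M(A)` of a set `A ⊆ M.E` in a finite matroid. -/
noncomputable def rankLack (M : Matroid α) (A : Set α) : ℕ := rk M M.E - rk M A

theorem coe_rk (M : Matroid α) [M.Finite] (A : Set α) : (rk M A : ℕ∞) = M.eRk A := by
  refine ENat.natCast_toNat ?_
  rw [← M.eRk_inter_ground]
  exact ne_top_of_le_ne_top
    (Set.encard_ne_top_iff.2 (M.ground_finite.subset Set.inter_subset_right))
    (M.eRk_le_encard _)

theorem rk_mono (M : Matroid α) [M.Finite] {A B : Set α} (h : A ⊆ B) : rk M A ≤ rk M B := by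
  have := M.eRk_mono h
  rw [← coe_rk, ← coe_rk] at this
  exact_mod_cast this

theorem rk_indep (M : Matroid α) {A : Set α} (h : M.Indep A) : rk M A = A.ncard := by
  rw [rk, h.eRk_eq_encard, Set.ncard]

theorem rk_le_ncard (M : Matroid α) [M.Finite] {A : Set α} (h : A ⊆ M.E) :
    rk M A ≤ A.ncard := by
  have h1 := M.eRk_le_encard A
  rw [← coe_rk, ← (M.ground_finite.subset h).cast_ncard_eq] at h1
  exact_mod_cast h1

theorem rk_insert_le (M : Matroid α) [M.Finite] (e : α) (A : Set α) :
    rk M (insert e A) ≤ rk M A + 1 := by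
  have h := M.eRk_insert_le_add_one e A
  rw [← coe_rk, ← coe_rk] at h
  exact_mod_cast h

/-- If a set has larger rank than another one, some element of it raises the rank. -/
theorem exists_rk_insert (M : Matroid α) [M.Finite] {A B : Set α} (h : rk M A < rk M B) :
    ∃ e ∈ B \ A, rk M (insert e A) = rk M A + 1 := by
  by_contra! hcon
  have hcl : ∀ e ∈ B, M.eRk (insert e A) = M.eRk A := by
    intro e he
    by_cases heA : e ∈ A
    · rw [Set.insert_eq_of_mem heA]
    · have h1 := hcon e ⟨he, heA⟩
      have h2 := rk_insert_le M e A
      have h3 := rk_mono M (Set.subset_insert e A)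
      rw [← coe_rk, ← coe_rk]
      have : rk M (insert e A) = rk M A := by omega
      rw [this]
  have hB : M.eRk (A ∪ B) = M.eRk A := by
    obtain ⟨I, hI⟩ := M.exists_isBasis' A
    have hIB : M.IsBasis' I (A ∪ B) := by
      refine Matroid.isBasis'_iff_isBasis_inter_ground.2
        (hI.indep.isBasis_of_forall_insert
          (Set.subset_inter (hI.subset.trans Set.subset_union_left) hI.indep.subset_ground) ?_)
      rintro e ⟨⟨heAB, heE⟩, heI⟩
      refine ⟨fun hi => ?_, Set.insert_subset heE hI.indep.subset_ground⟩
      rcases heAB with heA | heB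
      · exact heI (hI.mem_of_insert_indep heA hi)
      · have h1 : M.eRk (insert e I) ≤ M.eRk (insert e A) :=
          M.eRk_mono (Set.insert_subset_insert hI.subset)
        rw [hcl e heB, ← hI.encard_eq_eRk, hi.eRk_eq_encard,
          Set.encard_insert_of_notMem heI] at h1
        have hfin : I.encard ≠ ⊤ := Set.encard_ne_top_iff.2
          (M.ground_finite.subset hI.indep.subset_ground)
        exact (ENat.add_one_le_iff hfin).1 h1 |>.false
    rw [← hIB.encard_eq_eRk, hI.encard_eq_eRk]
  have h1 := rk_mono M (Set.subset_union_right : B ⊆ A ∪ B)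
  have h2 : rk M (A ∪ B) = rk M A := by rw [rk, hB, rk]
  omega

/-- Independence in the free product: `A ⊆ S + T` is independent iff `A ∩ S` is independent in `M`
and `λ_M(A ∩ S) ≥ ν_N(A ∩ T)`, where `S = M.E` and `T = N.E`. -/
def FreeProductIndep (M N : Matroid α) (A : Set α) : Prop :=
  A ⊆ M.E ∪ N.E ∧ M.Indep (A ∩ M.E) ∧ nullity N (A ∩ N.E) ≤ rankLack M (A ∩ M.E)

theorem FreeProductIndep.subset (M N : Matroid α) [M.Finite] [N.Finite] {I J : Set α}
    (hJ : FreeProductIndep M N J) (hIJ : I ⊆ J) : FreeProductIndep M N I := by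
  obtain ⟨h1, h2, h3⟩ := hJ
  refine ⟨hIJ.trans h1, h2.subset (Set.inter_subset_inter_left _ hIJ), ?_⟩
  have hM := rk_mono M (Set.inter_subset_inter_left M.E hIJ)
  have hN : nullity N (I ∩ N.E) ≤ nullity N (J ∩ N.E) := by
    have hs : I ∩ N.E ⊆ J ∩ N.E := Set.inter_subset_inter_left N.E hIJ
    have hfin : (J ∩ N.E).Finite := N.ground_finite.subset Set.inter_subset_right
    have a1 := Set.ncard_sdiff_add_ncard_of_subset hs hfin
    have a2 := N.eRk_union_le_eRk_add_eRk (I ∩ N.E) ((J ∩ N.E) \ (I ∩ N.E))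
    rw [Set.union_sdiff_cancel hs, ← coe_rk, ← coe_rk, ← coe_rk] at a2
    have a2' : rk N (J ∩ N.E) ≤ rk N (I ∩ N.E) + rk N ((J ∩ N.E) \ (I ∩ N.E)) := by
      exact_mod_cast a2
    have a3 := rk_le_ncard N (A := (J ∩ N.E) \ (I ∩ N.E))
      (Set.sdiff_subset.trans Set.inter_subset_right)
    unfold nullity
    omega
  unfold rankLack at *
  omega

theorem FreeProductIndep.aug (M N : Matroid α) [M.Finite] [N.Finite] (h : Disjoint M.E N.E)
    {I J : Set α} (hI : FreeProductIndep M N I) (hJ : FreeProductIndep M N J)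
    (hlt : I.ncard < J.ncard) : ∃ e ∈ J, e ∉ I ∧ FreeProductIndep M N (insert e I) := by
  have hMN : ∀ {e : α}, e ∈ M.E → e ∉ N.E := fun he he' => Set.disjoint_left.1 h he he'
  have split : ∀ A : Set α, A ⊆ M.E ∪ N.E → A.ncard = (A ∩ M.E).ncard + (A ∩ N.E).ncard := by
    intro A hA
    rw [← Set.ncard_union_eq (h.mono Set.inter_subset_right Set.inter_subset_right)
      (M.ground_finite.subset Set.inter_subset_right)
      (N.ground_finite.subset Set.inter_subset_right), ← Set.inter_union_distrib_left,
      Set.inter_eq_self_of_subset_left hA]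
  obtain ⟨i1, i2, i3⟩ := hI
  obtain ⟨j1, j2, j3⟩ := hJ
  have sI := split I i1
  have sJ := split J j1
  have rI := rk_indep M i2
  have rJ := rk_indep M j2
  have rI' := rk_mono M (Set.inter_subset_right : I ∩ M.E ⊆ M.E)
  have rJ' := rk_mono M (Set.inter_subset_right : J ∩ M.E ⊆ M.E)
  have nI := rk_le_ncard N (Set.inter_subset_right : I ∩ N.E ⊆ N.E)
  have nJ := rk_le_ncard N (Set.inter_subset_right : J ∩ N.E ⊆ N.E)
  have finN : (I ∩ N.E).Finite := N.ground_finite.subset Set.inter_subset_right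
  have finM : (I ∩ M.E).Finite := M.ground_finite.subset Set.inter_subset_right
  -- inserting an element of `N.E`
  have insN : ∀ e ∈ J, e ∉ I → e ∈ N.E →
      nullity N (insert e (I ∩ N.E)) ≤ rankLack M (I ∩ M.E) →
      ∃ e ∈ J, e ∉ I ∧ FreeProductIndep M N (insert e I) := by
    intro e heJ heI heN hle
    have e1 : insert e I ∩ N.E = insert e (I ∩ N.E) := Set.insert_inter_of_mem heN
    have e2 : insert e I ∩ M.E = I ∩ M.E :=
      Set.insert_inter_of_notMem fun he => hMN he heN
    refine ⟨e, heJ, heI, Set.insert_subset (j1 heJ) i1, ?_, ?_⟩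
    · rwa [e2]
    · rwa [e1, e2]
  by_cases hr : rk N (I ∩ N.E) < rk N (J ∩ N.E)
  · obtain ⟨e, ⟨⟨heJ, heN⟩, heI⟩, her⟩ := exists_rk_insert N hr
    have heI' : e ∉ I := fun hh => heI ⟨hh, heN⟩
    refine insN e heJ heI' heN ?_
    have c := Set.ncard_insert_of_notMem heI finN
    unfold nullity at *
    omega
  · by_cases hs : nullity N (I ∩ N.E) < rankLack M (I ∩ M.E)
    · by_cases hsub : J ∩ N.E ⊆ I ∩ N.E
      · have c := Set.ncard_le_ncard hsub finN
        have hr2 : rk M (I ∩ M.E) < rk M (J ∩ M.E) := by omega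
        obtain ⟨e, ⟨⟨heJ, heM⟩, heI⟩, her⟩ := exists_rk_insert M hr2
        have heI' : e ∉ I := fun hh => heI ⟨hh, heM⟩
        have e1 : insert e I ∩ M.E = insert e (I ∩ M.E) := Set.insert_inter_of_mem heM
        have e2 : insert e I ∩ N.E = I ∩ N.E := Set.insert_inter_of_notMem (hMN heM)
        refine ⟨e, heJ, heI', Set.insert_subset (j1 heJ) i1, ?_, ?_⟩
        · rw [e1, Matroid.indep_iff_eRk_eq_encard_of_finite (finM.insert e), ← coe_rk,
            ← (finM.insert e).cast_ncard_eq, her, Set.ncard_insert_of_notMem heI finM, rI]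
        · rw [e1, e2]
          unfold rankLack at *
          omega
      · obtain ⟨e, ⟨heJ, heN⟩, heI⟩ := Set.not_subset.1 hsub
        have heI' : e ∉ I := fun hh => heI ⟨hh, heN⟩
        refine insN e heJ heI' heN ?_
        have c := Set.ncard_insert_of_notMem heI finN
        have m := rk_mono N (Set.subset_insert e (I ∩ N.E))
        unfold nullity at *
        omega
    · unfold nullity rankLack at *
      omega

/-- The free product `M □ N` of two finite matroids with disjoint ground sets. -/
def freeProduct (M N : Matroid α) [M.Finite] [N.Finite] (h : Disjoint M.E N.E) : Matroid α :=
  (IndepMatroid.ofFinite (M.ground_finite.union N.ground_finite) (FreeProductIndep M N)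
    (by
      refine ⟨Set.empty_subset _, by simp, ?_⟩
      simp [nullity])
    (fun _ _ hJ hIJ => FreeProductIndep.subset M N hJ hIJ)
    (fun _ _ hI hJ hlt => FreeProductIndep.aug M N h hI hJ hlt)
    (fun _ hI => hI.1)).matroid

@[simp] theorem freeProduct_ground (M N : Matroid α) [M.Finite] [N.Finite]
    (h : Disjoint M.E N.E) : (freeProduct M N h).E = M.E ∪ N.E := rfl

theorem freeProduct_indep_iff (M N : Matroid α) [M.Finite] [N.Finite]
    (h : Disjoint M.E N.E) {A : Set α} :
    (freeProduct M N h).Indep A ↔ A ⊆ M.E ∪ N.E ∧ M.Indep (A ∩ M.E) ∧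
      nullity N (A ∩ N.E) ≤ rankLack M (A ∩ M.E) := by
  simp only [freeProduct, IndepMatroid.matroid_indep_iff]
  exact Iff.rfl

/-- A finite matroid is irreducible if it is nonempty and every factorization of it
as a free product contains the matroid itself as a factor. -/
def IsIrreducible (M : Matroid α) : Prop :=
  M.E.Nonempty ∧ ∀ (P Q : Matroid α) [P.Finite] [Q.Finite] (h : Disjoint P.E Q.E),
    M = freeProduct P Q h → P = M ∨ Q = M

/-- Isomorphism of matroids: a bijection of the ground sets that preserves and reflects
independence. -/
def IsIso (M : Matroid α) (N : Matroid β) : Prop :=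
  ∃ e : M.E ≃ N.E, ∀ I : Set M.E,
    M.Indep (Subtype.val '' I) ↔ N.Indep (Subtype.val '' (e '' I))

theorem IsIso.refl (M : Matroid α) : IsIso M M := ⟨Equiv.refl _, fun I => by simp⟩

theorem IsIso.symm {M : Matroid α} {N : Matroid β} (h : IsIso M N) : IsIso N M := by
  obtain ⟨e, he⟩ := h
  refine ⟨e.symm, fun I => ?_⟩
  rw [he (e.symm '' I), Equiv.image_symm_image]

theorem IsIso.trans {M : Matroid α} {N : Matroid β} {P : Matroid γ} (h : IsIso M N)
    (h' : IsIso N P) : IsIso M P := by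
  obtain ⟨e, he⟩ := h
  obtain ⟨f, hf⟩ := h'
  refine ⟨e.trans f, fun I => ?_⟩
  rw [he I, hf (e '' I), Set.image_image f e I]
  rfl

/-- Finite matroids whose elements are natural numbers. Every finite matroid is isomorphic to
one of these. -/
abbrev FinMatroid : Type := {M : Matroid ℕ // M.Finite}

/-- Every finite matroid, on any type, is represented in `FinMatroid`. -/
theorem exists_finMatroid_isIso (M : Matroid α) [M.Finite] :
    ∃ N : FinMatroid, IsIso M N.1 ∧ N.1.E = Set.Iio M.E.ncard := by
  have hc : Nat.card M.E = Nat.card (Set.Iio M.E.ncard) := by simp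
  have : Finite M.E := M.ground_finite
  obtain ⟨e⟩ := (Finite.card_eq (α := M.E) (β := Set.Iio M.E.ncard)).1 hc
  refine ⟨⟨M.mapSetEquiv e, ⟨Set.finite_Iio _⟩⟩, ⟨e, fun I => ?_⟩, rfl⟩
  rw [Matroid.mapSetEquiv_indep_iff]
  have : (Subtype.val '' (e '' I)) ⊆ Set.Iio M.E.ncard := by
    rintro _ ⟨x, -, rfl⟩
    exact x.2
  have h2 : e.symm '' (Subtype.val ⁻¹' (Subtype.val '' (e '' I))) = I := by
    rw [Set.preimage_image_eq _ Subtype.val_injective, Equiv.symm_image_image]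
  have h3 : M.Indep (Subtype.val '' I) ↔ M.Indep (Subtype.val ''
      (e.symm '' (Subtype.val ⁻¹' (Subtype.val '' (e '' I))))) := by rw [h2]
  exact ⟨fun hI => ⟨h3.1 hI, this⟩, fun hI => h3.2 hI.1⟩

/-- Isomorphism of finite matroids, as a setoid. -/
instance isoSetoid : Setoid FinMatroid where
  r M N := IsIso M.1 N.1
  iseqv := ⟨fun M => IsIso.refl M.1, IsIso.symm, IsIso.trans⟩

/-- The set of isomorphism classes of finite matroids with property `P`. -/
def isoClasses (P : Matroid ℕ → Prop) : Set (Quotient isoSetoid) :=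
  {c | ∃ M : FinMatroid, Quotient.mk isoSetoid M = c ∧ P M.1}

/-- There are only finitely many isomorphism classes of matroids on `n` elements. -/
theorem finite_isoClasses_size (n : ℕ) : (isoClasses fun M => M.E.ncard = n).Finite := by
  have hinj : Set.InjOn (fun M : FinMatroid => {I : Set ℕ | M.1.Indep I})
      {M : FinMatroid | M.1.E = Set.Iio n} := by
    intro M hM N hN h
    refine Subtype.ext (Matroid.ext_indep (hM.trans hN.symm) fun I _ => ?_)
    exact Set.ext_iff.1 h I
  have hfin : {M : FinMatroid | M.1.E = Set.Iio n}.Finite := by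
    refine Set.Finite.of_finite_image ((Set.finite_Iio n).finite_subsets.finite_subsets.subset ?_)
      hinj
    rintro _ ⟨M, hM, rfl⟩ I hI
    rw [Set.mem_ofPred_eq] at hM hI ⊢
    exact hM ▸ hI.subset_ground
  refine (hfin.image (Quotient.mk isoSetoid)).subset ?_
  rintro _ ⟨M, rfl, rfl⟩
  have := M.2
  obtain ⟨N, hN, hE⟩ := exists_finMatroid_isIso M.1
  exact ⟨N, hE, Quotient.sound hN.symm⟩

/-- There are only finitely many isomorphism classes of matroids of rank `r` and nullity `k`. -/
theorem finite_isoClasses_rank_nullity (r k : ℕ) :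
    (isoClasses fun M => rk M M.E = r ∧ nullity M M.E = k).Finite := by
  refine (finite_isoClasses_size (r + k)).subset ?_
  rintro _ ⟨M, rfl, h1, h2⟩
  have := M.2
  refine ⟨M, rfl, ?_⟩
  have := rk_le_ncard M.1 (Set.Subset.refl M.1.E)
  unfold nullity at h2
  omega

/-- `m_n`: the number of isomorphism classes of matroids on `n` elements. -/
noncomputable def numMatroids (n : ℕ) : ℕ := (isoClasses fun M => M.E.ncard = n).ncard

/-- `i_n`: the number of isomorphism classes of irreducible matroids on `n` elements. -/
noncomputable def numIrreducibles (n : ℕ) : ℕ :=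
  (isoClasses fun M => IsIrreducible M ∧ M.E.ncard = n).ncard

/-- `m_{r,k}`: the number of isomorphism classes of matroids of rank `r` and nullity `k`. -/
noncomputable def numMatroidsRN (r k : ℕ) : ℕ :=
  (isoClasses fun M => rk M M.E = r ∧ nullity M M.E = k).ncard

/-- `i_{r,k}`: the number of isomorphism classes of irreducible matroids of rank `r` and
nullity `k`. -/
noncomputable def numIrreduciblesRN (r k : ℕ) : ℕ :=
  (isoClasses fun M => IsIrreducible M ∧ rk M M.E = r ∧ nullity M M.E = k).ncard

/-- `M(t) = ∑ m_n t^n`. -/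
noncomputable def matroidSeries : PowerSeries ℚ :=
  PowerSeries.mk fun n => (numMatroids n : ℚ)

/-- `I(t) = ∑ i_n t^n`. -/
noncomputable def irreducibleSeries : PowerSeries ℚ :=
  PowerSeries.mk fun n => (numIrreducibles n : ℚ)

/-- `M(x, y) = ∑ m_{r,k} x^r y^k`, where `x` is variable `0` and `y` is variable `1`. -/
noncomputable def matroidSeriesRN : MvPowerSeries (Fin 2) ℚ :=
  fun s => (numMatroidsRN (s 0) (s 1) : ℚ)

/-- `I(x, y) = ∑ i_{r,k} x^r y^k`, where `x` is variable `0` and `y` is variable `1`. -/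
noncomputable def irreducibleSeriesRN : MvPowerSeries (Fin 2) ℚ :=
  fun s => (numIrreduciblesRN (s 0) (s 1) : ℚ)

end FreeProd

/-! The proof shows that every nonempty matroid is, up to isomorphism, an irreducible matroid times
an arbitrary matroid in exactly one way. Size, rank and nullity add up under the free product, so
counting such pairs gives `M = 1 + I * M` for both gradings, where the `1` is the empty matroid.
Since the empty matroid is not irreducible, `I` has constant term zero and `1 - I` is invertible.

Factorizations of `L` correspond to free separators `U`: the first factor must be the restriction to
`U`, the second the contraction by `U` (`isFreeSeparator_freeProduct`,
`IsFreeSeparator.eq_freeProduct`). The first factor is irreducible exactly when `U` is minimal among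
the nonempty free separators (`isIrreducible_restrict_iff`), which yields existence.

For uniqueness, free separators are closed under intersection, so distinct minimal ones `U` and `V`
are disjoint. Then both lie in the closure of every circuit, which makes them singletons `{a}` and
`{b}` (`IsFreeSeparator.eq_or_singletons`). The transposition of `a` and `b` is then an automorphism
of `L` exchanging the two factorizations (`mapEquiv_swap_eq_self`,
`exists_mapEquiv_of_freeProduct_eq`). -/

namespace FreeProd

variable {α : Type*}

/-- A set `U` of elements of `L` is a free separator if every circuit of `L` either lies in `U`
or spans `U`. -/
def IsFreeSeparator (L : Matroid α) (U : Set α) : Prop :=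
  U ⊆ L.E ∧ ∀ C, L.IsCircuit C → C ⊆ U ∨ U ⊆ L.closure C

/-! ### Ranks in restrictions and contractions -/

theorem rk_restrict (L : Matroid α) {U X : Set α} (h : X ⊆ U) : rk (L.restrict U) X = rk L X := by
  rw [rk, rk, L.restrict_eRk_eq h]

/-- A basis of `X` in the contraction together with a basis of `U` is a basis of `X ∪ U`. -/
theorem rk_contract (L : Matroid α) [L.Finite] {U X : Set α} (hU : U ⊆ L.E)
    (hX : X ⊆ L.E \ U) : rk (L.contract U) X + rk L U = rk L (X ∪ U) := by
  have hXE : X ∪ U ⊆ L.E := Set.union_subset (hX.trans Set.sdiff_subset) hU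
  obtain ⟨B, hB⟩ := L.exists_isBasis U
  obtain ⟨I, hI⟩ := (L.contract U).exists_isBasis X (by simpa using hX)
  have hIB : L.Indep (I ∪ B) := (hB.contract_indep_iff.1 hI.indep).1
  have hd : Disjoint U I := (hB.contract_indep_iff.1 hI.indep).2
  have hcl : L.closure (I ∪ B) = L.closure (I ∪ U) := by
    rw [← Matroid.closure_union_closure_right_eq, hB.closure_eq_closure,
      Matroid.closure_union_closure_right_eq]
  have hbas : L.IsBasis (I ∪ B) (X ∪ U) := by
    refine hIB.isBasis_of_subset_of_subset_closure (Set.union_subset_union hI.subset hB.subset) ?_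
    rw [hcl]
    refine Set.union_subset (fun x hx => ?_)
      (Set.subset_union_right.trans (L.subset_closure _
        (Set.union_subset (hI.subset.trans (hX.trans Set.sdiff_subset)) hU)))
    have := hI.subset_closure hx
    rw [Matroid.contract_closure_eq] at this
    exact this.1
  have hfin : (I ∪ B).Finite := L.ground_finite.subset hIB.subset_ground
  have h1 : rk (L.contract U) X = I.ncard := by
    rw [rk, ← hI.encard_eq_eRk, Set.ncard]
  have h2 : rk L U = B.ncard := by rw [rk, ← hB.encard_eq_eRk, Set.ncard]
  have h3 : rk L (X ∪ U) = (I ∪ B).ncard := by rw [rk, ← hbas.encard_eq_eRk, Set.ncard]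
  rw [h1, h2, h3, Set.ncard_union_eq (hd.symm.mono_right hB.subset)
    (hfin.subset Set.subset_union_left) (hfin.subset Set.subset_union_right)]

theorem rk_lt_ncard_of_not_indep (L : Matroid α) [L.Finite] {A : Set α} (hA : A ⊆ L.E)
    (h : ¬ L.Indep A) : rk L A < A.ncard := by
  refine lt_of_le_of_ne (rk_le_ncard L hA) fun he => h ?_
  have hfin := L.ground_finite.subset hA
  rw [Matroid.indep_iff_eRk_eq_encard_of_finite hfin, ← coe_rk, he, hfin.cast_ncard_eq]

/-! ### From factorizations to free separators -/

section Factors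

variable (P Q : Matroid α) [P.Finite] [Q.Finite] (h : Disjoint P.E Q.E)

instance freeProduct_finite : (freeProduct P Q h).Finite :=
  ⟨P.ground_finite.union Q.ground_finite⟩

theorem freeProduct_restrict : (freeProduct P Q h).restrict P.E = P := by
  refine Matroid.ext_indep rfl fun I hI => ?_
  have hIP : I ⊆ P.E := hI
  have h1 : I ∩ Q.E = ∅ := (h.mono_left hIP).inter_eq
  rw [Matroid.restrict_indep_iff, freeProduct_indep_iff, h1,
    Set.inter_eq_self_of_subset_left hIP]
  simp only [nullity, Set.ncard_empty, zero_tsub, zero_le, and_true]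
  exact ⟨fun hh => hh.1.2, fun hh => ⟨⟨hIP.trans Set.subset_union_left, hh⟩, hIP⟩⟩

/-- Adjoining a base `B` of `P` reduces the rank-lack to zero, so what remains of the independence
condition is that the part in `Q` has nullity zero. -/
theorem freeProduct_contract : (freeProduct P Q h).contract P.E = Q := by
  have hE : ((freeProduct P Q h).contract P.E).E = Q.E := by
    rw [Matroid.contract_ground, freeProduct_ground, Set.union_sdiff_left]
    exact h.symm.sdiff_eq_left
  refine Matroid.ext_indep hE fun I hI => ?_
  have hIQ : I ⊆ Q.E := hE ▸ hI
  obtain ⟨B, hB⟩ := P.exists_isBase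
  have hB' : (freeProduct P Q h).IsBasis B P.E := by
    rw [← Matroid.isBase_restrict_iff, freeProduct_restrict]
    exact hB
  have e1 : (I ∪ B) ∩ P.E = B := by
    rw [Set.union_inter_distrib_right, (h.symm.mono_left hIQ).inter_eq, Set.empty_union,
      Set.inter_eq_self_of_subset_left hB.subset_ground]
  have e2 : (I ∪ B) ∩ Q.E = I := by
    rw [Set.union_inter_distrib_right, (h.mono_left hB.subset_ground).inter_eq, Set.union_empty,
      Set.inter_eq_self_of_subset_left hIQ]
  have e3 : rk P P.E = rk P B := by rw [rk, rk, hB.eRk_eq_eRank, P.eRk_ground]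
  rw [hB'.contract_indep_iff_of_disjoint (h.mono_right hIQ), freeProduct_indep_iff, e1, e2]
  constructor
  · rintro ⟨-, -, h3⟩
    by_contra hd
    have := rk_lt_ncard_of_not_indep Q hIQ hd
    unfold nullity rankLack at h3
    omega
  · intro hi
    refine ⟨Set.union_subset (hIQ.trans Set.subset_union_right)
      (hB.subset_ground.trans Set.subset_union_left), hB.indep, ?_⟩
    rw [nullity, rk_indep Q hi]
    simp

/-- If a circuit `C` neither lies in `P.E` nor spans it, exchange some `f ∈ C` outside `P.E` for
some `e ∈ P.E` outside the closure of `C`. The result is independent. Undoing the exchange raises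
the rank-lack in `P` by one and the nullity in `Q` by at most one, so `C` would be independent too.
-/
theorem isFreeSeparator_freeProduct : IsFreeSeparator (freeProduct P Q h) P.E := by
  refine ⟨Set.subset_union_left, fun C hC => ?_⟩
  by_contra! hcon
  obtain ⟨hCP, hcl⟩ := hcon
  obtain ⟨f, hfC, hfP⟩ := Set.not_subset.1 hCP
  obtain ⟨e, heP, hecl⟩ := Set.not_subset.1 hcl
  have hCE : C ⊆ P.E ∪ Q.E := hC.subset_ground
  have hfQ : f ∈ Q.E := (hCE hfC).resolve_left hfP
  have heQ : e ∉ Q.E := Set.disjoint_left.1 h heP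
  have heC : e ∉ C := fun hh => hecl ((freeProduct P Q h).mem_closure_of_mem hh hC.subset_ground)
  have hins : (freeProduct P Q h).Indep (insert e (C \ {f})) := by
    rw [(hC.sdiff_singleton_indep hfC).insert_indep_iff]
    left
    rw [hC.closure_sdiff_singleton_eq]
    exact ⟨Or.inl heP, hecl⟩
  have hsub : ∀ A ⊆ P.E ∪ Q.E, A.Finite := fun A hA =>
    (P.ground_finite.union Q.ground_finite).subset hA
  have hCfin : C.Finite := hsub C hCE
  refine hC.dep.not_indep ?_
  rw [freeProduct_indep_iff] at hins ⊢
  obtain ⟨-, h2, h3⟩ := hins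
  have e1 : insert e (C \ {f}) ∩ P.E = insert e (C ∩ P.E) := by
    ext x
    simp only [Set.mem_inter_iff, Set.mem_insert_iff, Set.mem_sdiff, Set.mem_singleton_iff]
    constructor
    · tauto
    · rintro (rfl | ⟨h1, h2⟩)
      · tauto
      · exact ⟨Or.inr ⟨h1, fun hx => hfP (hx ▸ h2)⟩, h2⟩
  have e2 : insert e (C \ {f}) ∩ Q.E = (C ∩ Q.E) \ {f} := by
    ext x
    simp only [Set.mem_inter_iff, Set.mem_insert_iff, Set.mem_sdiff, Set.mem_singleton_iff]
    constructor
    · rintro ⟨rfl | hx, hxQ⟩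
      · exact absurd hxQ heQ
      · tauto
    · tauto
  rw [e1] at h2 h3
  rw [e2] at h3
  refine ⟨hCE, h2.subset (Set.subset_insert _ _), ?_⟩
  have c1 := rk_indep P h2
  have c2 := rk_indep P (h2.subset (Set.subset_insert _ _))
  rw [Set.ncard_insert_of_notMem (fun hh => heC hh.1) (hCfin.subset Set.inter_subset_left)] at c1
  have c3 : ((C ∩ Q.E) \ {f}).ncard + 1 = (C ∩ Q.E).ncard :=
    Set.ncard_sdiff_singleton_add_one ⟨hfC, hfQ⟩ (hCfin.subset Set.inter_subset_left)
  have c4 : rk Q ((C ∩ Q.E) \ {f}) ≤ rk Q (C ∩ Q.E) := rk_mono Q Set.sdiff_subset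
  have c5 := rk_mono P h2.subset_ground
  unfold nullity rankLack at *
  omega

end Factors

/-! ### From free separators to factorizations -/

theorem IsFreeSeparator.restrict_finite {L : Matroid α} [L.Finite] {U : Set α}
    (hU : IsFreeSeparator L U) : (L.restrict U).Finite := ⟨L.ground_finite.subset hU.1⟩

theorem disjoint_restrict_contract (L : Matroid α) (U : Set α) :
    Disjoint (L.restrict U).E (L.contract U).E := by
  rw [Matroid.restrict_ground_eq, Matroid.contract_ground]
  exact Set.disjoint_sdiff_right

/-- When `A ∩ U` is independent, the inequality defining the free product amounts to `|A| ≤ rk L (A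
∪ U)`, which holds for independent `A`. If `A` is dependent while `A ∩ U` is not, some circuit in
`A` leaves `U` and therefore spans it, so `rk L (A ∪ U) = rk L A < |A|`. -/
theorem IsFreeSeparator.eq_freeProduct {L : Matroid α} [L.Finite] {U : Set α}
    (hU : IsFreeSeparator L U) [(L.restrict U).Finite] :
    L = freeProduct (L.restrict U) (L.contract U) (disjoint_restrict_contract L U) := by
  refine Matroid.ext_indep ?_ fun A hA => ?_
  · simp [Set.union_sdiff_cancel hU.1]
  have hfin : A.Finite := L.ground_finite.subset hA
  have hAE : A ∩ (L.contract U).E = A \ U := by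
    ext x
    simp only [Matroid.contract_ground, Set.mem_inter_iff, Set.mem_sdiff]
    exact ⟨fun hx => ⟨hx.1, hx.2.2⟩, fun hx => ⟨hx.1, hA hx.1, hx.2⟩⟩
  have hAU : A ⊆ (L.restrict U).E ∪ (L.contract U).E := by
    simpa [Set.union_sdiff_cancel hU.1] using hA
  rw [freeProduct_indep_iff, hAE, Matroid.restrict_ground_eq, Matroid.restrict_indep_iff]
  rw [Matroid.restrict_ground_eq] at hAU
  have r1 := rk_contract L (X := A \ U) hU.1 (Set.sdiff_subset_sdiff_left hA)
  rw [Set.sdiff_union_self] at r1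
  have r2 : (A ∩ U).ncard + (A \ U).ncard = A.ncard :=
    Set.ncard_inter_add_ncard_sdiff_eq_ncard A U hfin
  have r3 := rk_restrict L (Set.inter_subset_right : A ∩ U ⊆ U)
  have r4 := rk_restrict L (Set.Subset.refl U)
  have r5 := rk_mono L (Set.inter_subset_right : A ∩ U ⊆ U)
  have r6 := rk_mono L (Set.subset_union_left : A ⊆ A ∪ U)
  have r7 := rk_mono L (Set.subset_union_right : U ⊆ A ∪ U)
  unfold nullity rankLack
  rw [Matroid.restrict_ground_eq, r3, r4]
  constructor
  · intro hi
    have q1 := rk_indep L hi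
    have q2 := rk_indep L (hi.subset (Set.inter_subset_left : A ∩ U ⊆ A))
    exact ⟨hAU, ⟨hi.subset Set.inter_subset_left, Set.inter_subset_right⟩, by omega⟩
  · rintro ⟨-, ⟨hi, -⟩, hle⟩
    have q2 := rk_indep L hi
    by_contra hd
    have q3 := rk_lt_ncard_of_not_indep L hA hd
    obtain ⟨C, hCA, hC⟩ := ((Matroid.not_indep_iff hA).1 hd).exists_isCircuit_subset
    rcases hU.2 C hC with hCU | hUC
    · exact hC.dep.not_indep (hi.subset (Set.subset_inter hCA hCU))
    · have q4 : rk L (A ∪ U) = rk L A := by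
        rw [rk, rk, ← L.eRk_closure_eq (A ∪ U), ← L.eRk_closure_eq A]
        congr 2
        refine subset_antisymm ?_ (L.closure_subset_closure Set.subset_union_left)
        rw [Matroid.closure_subset_closure_iff_subset_closure]
        exact Set.union_subset (L.subset_closure A) (hUC.trans (L.closure_subset_closure hCA))
      omega

/-! ### Minimal free separators and irreducibility -/

theorem isFreeSeparator_ground_self (L : Matroid α) : IsFreeSeparator L L.E :=
  ⟨subset_rfl, fun _ hC => Or.inl hC.subset_ground⟩

theorem IsFreeSeparator.inter {L : Matroid α} {U V : Set α} (hU : IsFreeSeparator L U)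
    (hV : IsFreeSeparator L V) : IsFreeSeparator L (U ∩ V) := by
  refine ⟨Set.inter_subset_left.trans hU.1, fun C hC => ?_⟩
  rcases hU.2 C hC with h1 | h1
  · rcases hV.2 C hC with h2 | h2
    · exact Or.inl (Set.subset_inter h1 h2)
    · exact Or.inr (Set.inter_subset_right.trans h2)
  · exact Or.inr (Set.inter_subset_left.trans h1)

theorem isFreeSeparator_restrict_iff {L : Matroid α} {U V : Set α} (hU : IsFreeSeparator L U)
    (hVU : V ⊆ U) : IsFreeSeparator (L.restrict U) V ↔ IsFreeSeparator L V := by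
  have hcl : ∀ C ⊆ U, (L.restrict U).closure C = L.closure C ∩ U := fun C hC =>
    L.restrict_closure_eq hC hU.1
  constructor
  · intro h
    refine ⟨hVU.trans hU.1, fun C hC => ?_⟩
    rcases hU.2 C hC with hCU | hUC
    · rcases h.2 C ((Matroid.restrict_isCircuit_iff hU.1).2 ⟨hC, hCU⟩) with h1 | h1
      · exact Or.inl h1
      · rw [hcl C hCU] at h1
        exact Or.inr (h1.trans Set.inter_subset_left)
    · exact Or.inr (hVU.trans hUC)
  · intro h
    refine ⟨hVU, fun C hC => ?_⟩
    obtain ⟨hC, hCU⟩ := (Matroid.restrict_isCircuit_iff hU.1).1 hC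
    rcases h.2 C hC with h1 | h1
    · exact Or.inl h1
    · rw [hcl C hCU]
      exact Or.inr (Set.subset_inter h1 hVU)

/-- The restriction to a free separator is irreducible iff the separator is minimal among the
nonempty ones. -/
theorem isIrreducible_restrict_iff {L : Matroid α} [L.Finite] {U : Set α}
    (hU : IsFreeSeparator L U) : IsIrreducible (L.restrict U) ↔
      U.Nonempty ∧ ∀ V ⊆ U, V.Nonempty → IsFreeSeparator L V → V = U := by
  have := hU.restrict_finite
  refine and_congr Iff.rfl ⟨fun h V hVU hV hVL => ?_, fun h P Q _ _ hd he => ?_⟩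
  · have hV' := (isFreeSeparator_restrict_iff hU hVU).2 hVL
    have := hV'.restrict_finite
    rcases h _ _ _ hV'.eq_freeProduct with h1 | h1
    · exact congrArg Matroid.E h1
    · have h2 : U \ V = U := congrArg Matroid.E h1
      obtain ⟨x, hx⟩ := hV
      have := hVU hx
      rw [← h2] at this
      exact absurd hx this.2
  · have hE : U = P.E ∪ Q.E := congrArg Matroid.E he
    have hP := isFreeSeparator_freeProduct P Q hd
    have h1 := freeProduct_restrict P Q hd
    have h2 := freeProduct_contract P Q hd
    rw [← he] at hP h1 h2
    have hPU : P.E ⊆ U := hE ▸ Set.subset_union_left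
    rcases P.E.eq_empty_or_nonempty with h0 | h0
    · right
      rw [h0, Matroid.contract_empty] at h2
      exact h2.symm
    · left
      have h3 := h P.E hPU h0 ((isFreeSeparator_restrict_iff hU hPU).1 hP)
      rw [h3, Matroid.restrict_restrict_eq _ subset_rfl] at h1
      exact h1.symm

theorem exists_isFreeSeparator_isIrreducible (L : Matroid α) [L.Finite] (h : L.E.Nonempty) :
    ∃ U, IsFreeSeparator L U ∧ IsIrreducible (L.restrict U) := by
  have hfin : {U | U.Nonempty ∧ IsFreeSeparator L U}.Finite :=
    L.ground_finite.finite_subsets.subset fun U hU => hU.2.1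
  obtain ⟨U, hU⟩ := hfin.exists_minimal ⟨L.E, h, isFreeSeparator_ground_self L⟩
  refine ⟨U, hU.prop.2, (isIrreducible_restrict_iff hU.prop.2).2
    ⟨hU.prop.1, fun V hVU hV hVL => ?_⟩⟩
  exact hU.eq_of_subset ⟨hV, hVL⟩ hVU

/-- Two different minimal free separators are singletons, and both lie in the closure of every
circuit. -/
theorem IsFreeSeparator.eq_or_singletons {L : Matroid α} [L.Finite] {U V : Set α}
    (hU : IsFreeSeparator L U) (hV : IsFreeSeparator L V) (hU' : IsIrreducible (L.restrict U))
    (hV' : IsIrreducible (L.restrict V)) :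
    U = V ∨ ∃ a b, U = {a} ∧ V = {b} ∧ a ≠ b ∧
      ∀ C, L.IsCircuit C → a ∈ L.closure C ∧ b ∈ L.closure C := by
  obtain ⟨⟨a, ha⟩, hUm⟩ := (isIrreducible_restrict_iff hU).1 hU'
  obtain ⟨⟨b, hb⟩, hVm⟩ := (isIrreducible_restrict_iff hV).1 hV'
  rcases (U ∩ V).eq_empty_or_nonempty with h0 | h0
  · right
    have hd : Disjoint U V := Set.disjoint_iff_inter_eq_empty.2 h0
    -- A circuit `C ⊆ U` cannot lie in `V`, so it spans `b`. A circuit `C'` through `b` within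
    -- `insert b C` is not contained in `U`, hence spans `U`, and `C'` lies in the closure of `C`.
    have key : ∀ {U V : Set α} {b : α}, IsFreeSeparator L U → IsFreeSeparator L V →
        Disjoint U V → b ∈ V → ∀ C, L.IsCircuit C → U ⊆ L.closure C := by
      intro U V b hU hV hd hb C hC
      refine (hU.2 C hC).elim (fun hCU => ?_) id
      rcases hV.2 C hC with hCV | hVC
      · obtain ⟨x, hx⟩ := hC.nonempty
        exact absurd (hCV hx) (Set.disjoint_left.1 hd (hCU hx))
      · have hbC : b ∉ C := fun hh => Set.disjoint_left.1 hd (hCU hh) hb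
        obtain ⟨C', hC'C, hC', hbC'⟩ := Matroid.exists_isCircuit_of_mem_closure (hVC hb) hbC
        rcases hU.2 C' hC' with h1 | h1
        · exact absurd hb (Set.disjoint_left.1 hd (h1 hbC'))
        · refine h1.trans (L.closure_subset_closure_of_subset_closure (hC'C.trans ?_))
          exact Set.insert_subset (hVC hb) (L.subset_closure C hC.subset_ground)
    have kU := key hU hV hd hb
    have kV := key hV hU hd.symm ha
    refine ⟨a, b, ?_, ?_, ?_, fun C hC => ⟨kU C hC ha, kV C hC hb⟩⟩
    -- A point in the closure of every circuit is by itself a free separator, so minimality leaves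
    -- only that point.
    · exact (hUm {a} (Set.singleton_subset_iff.2 ha) (Set.singleton_nonempty a)
        ⟨Set.singleton_subset_iff.2 (hU.1 ha), fun C hC =>
          Or.inr (Set.singleton_subset_iff.2 (kU C hC ha))⟩).symm
    · exact (hVm {b} (Set.singleton_subset_iff.2 hb) (Set.singleton_nonempty b)
        ⟨Set.singleton_subset_iff.2 (hV.1 hb), fun C hC =>
          Or.inr (Set.singleton_subset_iff.2 (kV C hC hb))⟩).symm
    · rintro rfl
      exact Set.disjoint_left.1 hd ha hb
  · left
    rw [← hUm _ Set.inter_subset_left h0 (hU.inter hV)]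
    exact hVm _ Set.inter_subset_right h0 (hU.inter hV)

/-- Elements that lie in the closure of every circuit can be exchanged. -/
theorem indep_insert_of_forall_mem_closure {L : Matroid α} {a b : α} {A : Set α}
    (hb : b ∈ L.E) (hcl : ∀ C, L.IsCircuit C → a ∈ L.closure C) (haA : a ∉ A)
    (hA : L.Indep (insert a A)) : L.Indep (insert b A) := by
  have hA' : L.Indep A := hA.subset (Set.subset_insert a A)
  by_contra hd
  have hbA : b ∈ L.closure A := by
    by_contra hbA
    exact hd (hA'.insert_indep_iff.2 (Or.inl ⟨hb, hbA⟩))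
  have hE : insert b A ⊆ L.E := Set.insert_subset hb hA'.subset_ground
  -- This circuit lies in the closure of `A`, and its own closure contains `a`; hence `a` is spanned
  -- by `A`.
  obtain ⟨C, hCA, hC⟩ := ((Matroid.not_indep_iff hE).1 hd).exists_isCircuit_subset
  have ha : a ∈ L.closure A := by
    refine L.closure_subset_closure_of_subset_closure (hCA.trans ?_) (hcl C hC)
    exact Set.insert_subset hbA (L.subset_closure A)
  exact (hA'.notMem_closure_iff_of_notMem haA (hA.subset_ground (Set.mem_insert a A))).2 hA ha

/-! ### Transport along bijections and unique factorization -/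

section Map

variable {α β : Type*}

theorem rk_mapEquiv (M : Matroid α) (σ : α ≃ β) (X : Set α) :
    rk (M.mapEquiv σ) (σ '' X) = rk M X := by
  obtain ⟨I, hI⟩ := M.exists_isBasis (X ∩ M.E)
  have hI' : (M.mapEquiv σ).IsBasis (σ '' I) (σ '' (X ∩ M.E)) := by
    rw [Matroid.mapEquiv_isBasis_iff, Equiv.symm_image_image, Equiv.symm_image_image]
    exact hI
  rw [rk, rk, ← M.eRk_inter_ground X, ← hI.encard_eq_eRk, ← (M.mapEquiv σ).eRk_inter_ground,
    Matroid.mapEquiv_ground_eq, ← Set.image_inter σ.injective, ← hI'.encard_eq_eRk,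
    σ.injective.encard_image]

theorem nullity_mapEquiv (M : Matroid α) (σ : α ≃ β) (X : Set α) :
    nullity (M.mapEquiv σ) (σ '' X) = nullity M X := by
  rw [nullity, nullity, rk_mapEquiv, Set.ncard_image_of_injective X σ.injective]

theorem rankLack_mapEquiv (M : Matroid α) (σ : α ≃ β) (X : Set α) :
    rankLack (M.mapEquiv σ) (σ '' X) = rankLack M X := by
  rw [rankLack, rankLack, rk_mapEquiv, Matroid.mapEquiv_ground_eq, rk_mapEquiv]

theorem mapEquiv_indep_image_iff {M : Matroid α} {σ : α ≃ β} {X : Set α} :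
    (M.mapEquiv σ).Indep (σ '' X) ↔ M.Indep X := by
  rw [Matroid.mapEquiv_indep_iff, Equiv.symm_image_image]

theorem mapEquiv_symm_mapEquiv (M : Matroid α) (σ : α ≃ β) :
    (M.mapEquiv σ).mapEquiv σ.symm = M := by
  refine Matroid.ext_indep (by simp) fun I _ => ?_
  rw [Matroid.mapEquiv_indep_iff, Matroid.mapEquiv_indep_iff, Equiv.symm_symm,
    Equiv.symm_image_image]

theorem mapEquiv_congr (M : Matroid α) {σ τ : α ≃ β} (h : Set.EqOn σ τ M.E) :
    M.mapEquiv σ = M.mapEquiv τ := by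
  refine Matroid.ext_indep h.image_eq fun I hI => ?_
  obtain ⟨J, hJ, rfl⟩ : ∃ J ⊆ M.E, σ '' J = I := Set.subset_image_iff.1 hI
  rw [mapEquiv_indep_image_iff, (h.mono hJ).image_eq, mapEquiv_indep_image_iff]

theorem freeProduct_mapEquiv (P Q : Matroid α) [P.Finite] [Q.Finite] (h : Disjoint P.E Q.E)
    (σ : α ≃ β) (h' : Disjoint (P.mapEquiv σ).E (Q.mapEquiv σ).E) :
    (freeProduct P Q h).mapEquiv σ = freeProduct (P.mapEquiv σ) (Q.mapEquiv σ) h' := by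
  refine Matroid.ext_indep (Set.image_union _ _ _) fun I hI => ?_
  obtain ⟨J, hJ, rfl⟩ : ∃ J ⊆ P.E ∪ Q.E, σ '' J = I := Set.subset_image_iff.1 hI
  rw [mapEquiv_indep_image_iff, freeProduct_indep_iff, freeProduct_indep_iff,
    Matroid.mapEquiv_ground_eq, Matroid.mapEquiv_ground_eq, ← Set.image_inter σ.injective,
    ← Set.image_inter σ.injective, nullity_mapEquiv, rankLack_mapEquiv, mapEquiv_indep_image_iff,
    ← Set.image_union, Set.image_subset_image_iff σ.injective]

theorem disjoint_mapEquiv {P Q : Matroid α} (h : Disjoint P.E Q.E) (σ : α ≃ β) :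
    Disjoint (P.mapEquiv σ).E (Q.mapEquiv σ).E :=
  (Set.disjoint_image_iff σ.injective).2 h

theorem IsIrreducible.mapEquiv {M : Matroid α} (hM : IsIrreducible M) (σ : α ≃ β) :
    IsIrreducible (M.mapEquiv σ) := by
  refine ⟨hM.1.image σ, fun P Q _ _ h he => ?_⟩
  have h1 : M = (freeProduct P Q h).mapEquiv σ.symm := by rw [← he, mapEquiv_symm_mapEquiv]
  rw [freeProduct_mapEquiv P Q h σ.symm (disjoint_mapEquiv h _)] at h1
  have h2 : ∀ R : Matroid β, R.mapEquiv σ.symm = M → R = M.mapEquiv σ := fun R hR => by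
    rw [← hR, ← mapEquiv_symm_mapEquiv R σ.symm, Equiv.symm_symm, mapEquiv_symm_mapEquiv]
  exact (hM.2 _ _ _ h1).imp (h2 P) (h2 Q)

theorem freeProduct_congr {P Q P' Q' : Matroid α} [P.Finite] [Q.Finite] [P'.Finite] [Q'.Finite]
    (h : Disjoint P.E Q.E) (h' : Disjoint P'.E Q'.E) (hP : P = P') (hQ : Q = Q') :
    freeProduct P Q h = freeProduct P' Q' h' := by
  subst hP hQ
  rfl

/-- The factors of a free product are determined by the ground set of the first one. -/
theorem freeProduct_inj {P Q P' Q' : Matroid α} [P.Finite] [Q.Finite] [P'.Finite] [Q'.Finite]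
    {h : Disjoint P.E Q.E} {h' : Disjoint P'.E Q'.E} (hE : P.E = P'.E)
    (he : freeProduct P Q h = freeProduct P' Q' h') : P = P' ∧ Q = Q' := by
  constructor
  · rw [← freeProduct_restrict P Q h, ← freeProduct_restrict P' Q' h', he, hE]
  · rw [← freeProduct_contract P Q h, ← freeProduct_contract P' Q' h', he, hE]

/-- The swap replaces `a` by `b` or `b` by `a` in a set containing exactly one of them, and fixes
every other set. As it is an involution, preserving independence in one direction suffices. -/
theorem mapEquiv_swap_eq_self [DecidableEq α] {L : Matroid α} {a b : α} (ha : a ∈ L.E)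
    (hb : b ∈ L.E)
    (hcl : ∀ C, L.IsCircuit C → a ∈ L.closure C ∧ b ∈ L.closure C) :
    L.mapEquiv (Equiv.swap a b) = L := by
  have himg : ∀ A : Set α, L.Indep A → L.Indep (Equiv.swap a b '' A) := by
    intro A hA
    by_cases h1 : a ∈ A <;> by_cases h2 : b ∈ A
    · convert hA using 1
      ext x
      simp only [Equiv.image_eq_preimage_symm, Equiv.symm_swap, Set.mem_preimage]
      rcases eq_or_ne x a with rfl | hxa
      · simp [h1, h2]
      rcases eq_or_ne x b with rfl | hxb
      · simp [h1, h2]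
      · rw [Equiv.swap_apply_of_ne_of_ne hxa hxb]
    · have e : Equiv.swap a b '' A = insert b (A \ {a}) := by
        ext x
        simp only [Equiv.image_eq_preimage_symm, Equiv.symm_swap, Set.mem_preimage]
        rcases eq_or_ne x a with rfl | hxa
        · simp [h2]
          rintro rfl
          exact h2 h1
        rcases eq_or_ne x b with rfl | hxb
        · simp [h1]
        · simp [Equiv.swap_apply_of_ne_of_ne hxa hxb, hxa, hxb]
      rw [e]
      refine indep_insert_of_forall_mem_closure hb (fun C hC => (hcl C hC).1) (by simp) ?_
      rwa [Set.insert_sdiff_singleton, Set.insert_eq_of_mem h1]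
    · have e : Equiv.swap a b '' A = insert a (A \ {b}) := by
        ext x
        simp only [Equiv.image_eq_preimage_symm, Equiv.symm_swap, Set.mem_preimage]
        rcases eq_or_ne x b with rfl | hxb
        · simp [h1]
          rintro rfl
          exact h1 h2
        rcases eq_or_ne x a with rfl | hxa
        · simp [h2]
        · simp [Equiv.swap_apply_of_ne_of_ne hxa hxb, hxa, hxb]
      rw [e]
      refine indep_insert_of_forall_mem_closure ha (fun C hC => (hcl C hC).2) (by simp) ?_
      rwa [Set.insert_sdiff_singleton, Set.insert_eq_of_mem h2]
    · convert hA using 1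
      ext x
      simp only [Equiv.image_eq_preimage_symm, Equiv.symm_swap, Set.mem_preimage]
      rcases eq_or_ne x a with rfl | hxa
      · simp [h1, h2]
      rcases eq_or_ne x b with rfl | hxb
      · simp [h1, h2]
      · rw [Equiv.swap_apply_of_ne_of_ne hxa hxb]
  have hE : Equiv.swap a b '' L.E = L.E := by
    ext x
    simp only [Equiv.image_eq_preimage_symm, Equiv.symm_swap, Set.mem_preimage]
    rcases eq_or_ne x a with rfl | hxa
    · simp [ha, hb]
    rcases eq_or_ne x b with rfl | hxb
    · simp [ha, hb]
    · rw [Equiv.swap_apply_of_ne_of_ne hxa hxb]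
  refine Matroid.ext_indep hE fun I _ => ?_
  rw [Matroid.mapEquiv_indep_iff, Equiv.symm_swap]
  refine ⟨fun h => ?_, himg I⟩
  have := himg _ h
  simpa [Set.image_image] using this

/-- Unique factorization: the irreducible first factor of a matroid and the remaining factor are
determined up to a permutation. -/
theorem exists_mapEquiv_of_freeProduct_eq {P Q P' Q' : Matroid α} [P.Finite] [Q.Finite]
    [P'.Finite] [Q'.Finite] {h : Disjoint P.E Q.E} {h' : Disjoint P'.E Q'.E}
    (hP : IsIrreducible P) (hP' : IsIrreducible P')
    (he : freeProduct P Q h = freeProduct P' Q' h') :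
    ∃ σ : Equiv.Perm α, P' = P.mapEquiv σ ∧ Q' = Q.mapEquiv σ := by
  classical
  have f1 := isFreeSeparator_freeProduct P Q h
  have f2 := isFreeSeparator_freeProduct P' Q' h'
  have r2 := freeProduct_restrict P' Q' h'
  rw [← he] at f2 r2
  rcases f1.eq_or_singletons f2 (by rwa [freeProduct_restrict]) (by rwa [r2]) with
    hE | ⟨a, b, ha, hb, -, hcl⟩
  · obtain ⟨rfl, rfl⟩ := freeProduct_inj hE he
    have hid : ∀ M : Matroid α, M = M.mapEquiv (Equiv.refl α) := fun M =>
      Matroid.ext_indep (by simp) fun I _ => by simp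
    exact ⟨Equiv.refl α, hid P, hid Q⟩
  · have hs := mapEquiv_swap_eq_self (f1.1 (ha ▸ Set.mem_singleton a))
      (f2.1 (hb ▸ Set.mem_singleton b)) hcl
    rw [freeProduct_mapEquiv P Q h _ (disjoint_mapEquiv h _), he] at hs
    -- The swapped factorization has first ground set `{b}`, the same as that of `P'`.
    obtain ⟨h1, h2⟩ := freeProduct_inj (by simp [ha, hb]) hs
    exact ⟨_, h1.symm, h2.symm⟩

end Map

/-! ### Isomorphisms as permutations of `ℕ` -/

section Nat

/-- The complements of `X` and of its image are both countably infinite, so any bijection between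
them completes `f` to a permutation. -/
theorem exists_perm_eqOn {X : Set ℕ} (hX : X.Finite) {f : ℕ → ℕ} (hf : Set.InjOn f X) :
    ∃ σ : Equiv.Perm ℕ, Set.EqOn σ f X := by
  classical
  have : Infinite {x // ¬ x ∈ X} := hX.infinite_compl.to_subtype
  have : Infinite {x // ¬ x ∈ f '' X} := (hX.image f).infinite_compl.to_subtype
  obtain ⟨e⟩ : Nonempty ({x // ¬ x ∈ X} ≃ {x // ¬ x ∈ f '' X}) := nonempty_equiv_of_countable
  refine ⟨Equiv.subtypeCongr (Equiv.Set.imageOfInjOn f X hf) e, fun x hx => ?_⟩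
  simp [Equiv.subtypeCongr, Equiv.sumCompl_symm_apply_of_pos hx, Equiv.Set.imageOfInjOn]

theorem isIso_mapEquiv {α β : Type*} (M : Matroid α) (σ : α ≃ β) : IsIso M (M.mapEquiv σ) := by
  refine ⟨σ.image M.E, fun I => ?_⟩
  rw [← mapEquiv_indep_image_iff (σ := σ)]
  refine iff_of_eq (congrArg _ ?_)
  rw [Set.image_image, Set.image_image]
  rfl

theorem isIso_iff_exists_perm {M N : Matroid ℕ} [M.Finite] :
    IsIso M N ↔ ∃ σ : Equiv.Perm ℕ, N = M.mapEquiv σ := by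
  classical
  refine ⟨?_, fun ⟨σ, hσ⟩ => hσ ▸ isIso_mapEquiv M σ⟩
  rintro ⟨e, he⟩
  have hinj : Set.InjOn (fun x => if h : x ∈ M.E then (e ⟨x, h⟩ : ℕ) else 0) M.E := by
    intro x hx y hy hxy
    simp only [hx, hy, dif_pos] at hxy
    simpa using e.injective (Subtype.val_injective hxy)
  obtain ⟨σ, hσ⟩ := exists_perm_eqOn M.ground_finite hinj
  have hσe : ∀ x : M.E, σ x = e x := fun x => by simp [hσ x.2]
  have himg : ∀ I : Set M.E, σ '' (Subtype.val '' I) = Subtype.val '' (e '' I) := by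
    intro I
    rw [Set.image_image, Set.image_image]
    exact Set.image_congr fun x _ => hσe x
  have hE : N.E = σ '' M.E := by
    have := himg Set.univ
    rw [Set.image_univ, Set.image_univ, e.range_eq_univ, Set.image_univ, Subtype.range_val,
      Subtype.range_val] at this
    exact this.symm
  refine ⟨σ, Matroid.ext_indep hE fun I hI => ?_⟩
  rw [hE] at hI
  obtain ⟨J, hJ, rfl⟩ : ∃ J ⊆ M.E, σ '' J = I := Set.subset_image_iff.1 hI
  obtain ⟨K, rfl⟩ : ∃ K : Set M.E, Subtype.val '' K = J :=
    ⟨Subtype.val ⁻¹' J, by simpa using hJ⟩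
  rw [mapEquiv_indep_image_iff, he K, himg K]

/-- The two permutations are glued on the disjoint ground sets and the result is extended to all of
`ℕ`. This makes the product of isomorphism classes well defined. -/
theorem freeProduct_isIso {P Q P' Q' : Matroid ℕ} [P.Finite] [Q.Finite] [P'.Finite] [Q'.Finite]
    (h : Disjoint P.E Q.E) (h' : Disjoint P'.E Q'.E) (hP : IsIso P P') (hQ : IsIso Q Q') :
    IsIso (freeProduct P Q h) (freeProduct P' Q' h') := by
  classical
  obtain ⟨σ, rfl⟩ := isIso_iff_exists_perm.1 hP
  obtain ⟨τ, rfl⟩ := isIso_iff_exists_perm.1 hQ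
  have e1 : Set.EqOn (P.E.piecewise σ τ) σ P.E := Set.piecewise_eqOn _ _ _
  have e2 : Set.EqOn (P.E.piecewise σ τ) τ Q.E :=
    (Set.piecewise_eqOn_compl _ _ _).mono h.subset_compl_left
  have hinj : Set.InjOn (P.E.piecewise σ τ) (P.E ∪ Q.E) := by
    rw [Set.injOn_union h]
    refine ⟨σ.injective.injOn.congr e1.symm, τ.injective.injOn.congr e2.symm,
      fun x hx y hy hxy => ?_⟩
    rw [e1 hx, e2 hy] at hxy
    exact Set.disjoint_left.1 h' (Set.mem_image_of_mem σ hx) (hxy ▸ Set.mem_image_of_mem τ hy)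
  obtain ⟨π, hπ⟩ := exists_perm_eqOn (P.ground_finite.union Q.ground_finite) hinj
  refine isIso_iff_exists_perm.2 ⟨π, ?_⟩
  rw [freeProduct_mapEquiv P Q h π (disjoint_mapEquiv h π)]
  refine freeProduct_congr _ _ (mapEquiv_congr P fun x hx => ?_) (mapEquiv_congr Q fun x hx => ?_)
  · rw [hπ (Or.inl hx), e1 hx]
  · rw [hπ (Or.inr hx), e2 hx]

end Nat

/-! ### Additivity of rank, size and nullity -/

theorem rk_freeProduct {α : Type*} (P Q : Matroid α) [P.Finite] [Q.Finite]
    (h : Disjoint P.E Q.E) :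
    rk (freeProduct P Q h) (P.E ∪ Q.E) = rk P P.E + rk Q Q.E := by
  have r := rk_contract (freeProduct P Q h) (U := P.E) (X := Q.E) Set.subset_union_left
    (by rw [freeProduct_ground, Set.union_sdiff_left, h.symm.sdiff_eq_left])
  rw [← rk_restrict _ (Set.Subset.refl P.E), freeProduct_restrict, freeProduct_contract,
    Set.union_comm] at r
  omega

theorem ncard_ground_freeProduct {α : Type*} (P Q : Matroid α) [P.Finite] [Q.Finite]
    (h : Disjoint P.E Q.E) : (freeProduct P Q h).E.ncard = P.E.ncard + Q.E.ncard :=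
  Set.ncard_union_eq h P.ground_finite Q.ground_finite

theorem nullity_freeProduct {α : Type*} (P Q : Matroid α) [P.Finite] [Q.Finite]
    (h : Disjoint P.E Q.E) :
    nullity (freeProduct P Q h) (P.E ∪ Q.E) = nullity P P.E + nullity Q Q.E := by
  -- These bounds make the truncated subtractions in the nullities of the factors exact.
  have h1 := rk_le_ncard P (Set.Subset.refl P.E)
  have h2 := rk_le_ncard Q (Set.Subset.refl Q.E)
  have h3 := ncard_ground_freeProduct P Q h
  have h4 := rk_freeProduct P Q h
  rw [freeProduct_ground] at h3
  unfold nullity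
  omega

/-- Isomorphism classes of finite matroids. -/
abbrev MatroidClass : Type := Quotient isoSetoid

/-! ### Products of isomorphism classes and the counting recurrence -/

namespace MatroidClass

/-- The isomorphism class of a finite matroid. -/
def of (M : Matroid ℕ) [h : M.Finite] : MatroidClass := Quotient.mk isoSetoid ⟨M, h⟩

theorem of_eq_of_iff {M N : Matroid ℕ} [M.Finite] [N.Finite] : of M = of N ↔ IsIso M N :=
  ⟨fun h => Quotient.exact h, fun h => Quotient.sound h⟩

theorem of_mapEquiv (M : Matroid ℕ) [M.Finite] (σ : Equiv.Perm ℕ) :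
    of (M.mapEquiv σ) = of M :=
  (of_eq_of_iff.2 (isIso_mapEquiv M σ)).symm

theorem exists_of (c : MatroidClass) : ∃ (M : Matroid ℕ) (_ : M.Finite), of M = c := by
  induction c using Quotient.inductionOn with
  | h M => exact ⟨M.1, M.2, rfl⟩

theorem exists_disjoint (c d : MatroidClass) : ∃ (P Q : Matroid ℕ) (_ : P.Finite) (_ : Q.Finite),
    Disjoint P.E Q.E ∧ of P = c ∧ of Q = d := by
  obtain ⟨P, hP, rfl⟩ := exists_of c
  obtain ⟨Q, hQ, rfl⟩ := exists_of d
  obtain ⟨n, hn⟩ := P.ground_finite.bddAbove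
  -- The shift by `n + 1` moves the elements of `Q` beyond all those of `P`.
  obtain ⟨σ, hσ⟩ := exists_perm_eqOn Q.ground_finite (f := fun x => x + (n + 1))
    (add_left_injective (n + 1)).injOn
  refine ⟨P, Q.mapEquiv σ, hP, inferInstance, ?_, rfl, of_mapEquiv Q σ⟩
  rw [Set.disjoint_left]
  rintro _ hx ⟨y, hy, rfl⟩
  have h1 : σ y ≤ n := hn hx
  have h2 : σ y = y + (n + 1) := hσ hy
  omega

theorem exists_mul (c d : MatroidClass) : ∃ e : MatroidClass,
    ∀ (P Q : Matroid ℕ) [P.Finite] [Q.Finite] (h : Disjoint P.E Q.E),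
      of P = c → of Q = d → of (freeProduct P Q h) = e := by
  obtain ⟨P, Q, _, _, h, rfl, rfl⟩ := exists_disjoint c d
  refine ⟨of (freeProduct P Q h), fun P' Q' _ _ h' hP hQ => ?_⟩
  exact of_eq_of_iff.2 (freeProduct_isIso h' h (of_eq_of_iff.1 hP) (of_eq_of_iff.1 hQ))

/-- The free product of two isomorphism classes. -/
noncomputable def mul (c d : MatroidClass) : MatroidClass := (exists_mul c d).choose

theorem mul_of (P Q : Matroid ℕ) [P.Finite] [Q.Finite] (h : Disjoint P.E Q.E) :
    mul (of P) (of Q) = of (freeProduct P Q h) :=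
  ((exists_mul (of P) (of Q)).choose_spec P Q h rfl rfl).symm

/-- The classes of irreducible matroids. -/
def irreducibles : Set MatroidClass := {c | ∃ (M : Matroid ℕ) (_ : M.Finite), of M = c ∧
  IsIrreducible M}

theorem of_mem_irreducibles {M : Matroid ℕ} [M.Finite] :
    of M ∈ irreducibles ↔ IsIrreducible M := by
  refine ⟨?_, fun h => ⟨M, _, rfl, h⟩⟩
  rintro ⟨N, _, he, hN⟩
  obtain ⟨σ, rfl⟩ := isIso_iff_exists_perm.1 (of_eq_of_iff.1 he)
  exact hN.mapEquiv σ

/-- Moving one product onto the other by a permutation makes them equal, and unique factorization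
then matches the factors up to a second permutation. -/
theorem mul_injOn : Set.InjOn (fun p : MatroidClass × MatroidClass => mul p.1 p.2)
    (irreducibles ×ˢ Set.univ) := by
  rintro ⟨c, d⟩ ⟨hc, -⟩ ⟨c', d'⟩ ⟨hc', -⟩ he
  obtain ⟨P, Q, _, _, h, rfl, rfl⟩ := exists_disjoint c d
  obtain ⟨P', Q', _, _, h', rfl, rfl⟩ := exists_disjoint c' d'
  simp only [of_mem_irreducibles] at hc hc'
  simp only [mul_of _ _ h, mul_of _ _ h'] at he
  obtain ⟨σ, hσ⟩ := isIso_iff_exists_perm.1 (of_eq_of_iff.1 he)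
  rw [freeProduct_mapEquiv P Q h σ (disjoint_mapEquiv h σ)] at hσ
  obtain ⟨τ, rfl, rfl⟩ := exists_mapEquiv_of_freeProduct_eq (hc.mapEquiv σ) hc' hσ.symm
  simp only [of_mapEquiv]

theorem exists_mul_eq (M : Matroid ℕ) [M.Finite] (hM : M.E.Nonempty) :
    ∃ c ∈ irreducibles, ∃ d, mul c d = of M := by
  obtain ⟨U, hU, hirr⟩ := exists_isFreeSeparator_isIrreducible M hM
  have := hU.restrict_finite
  refine ⟨of (M.restrict U), of_mem_irreducibles.2 hirr, of (M.contract U), ?_⟩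
  rw [mul_of _ _ (disjoint_restrict_contract M U), of_eq_of_iff, ← hU.eq_freeProduct]
  exact IsIso.refl M

theorem of_emptyOn_notMem_irreducibles : of (Matroid.emptyOn ℕ) ∉ irreducibles := by
  rw [of_mem_irreducibles]
  exact fun h => by simpa using h.1

theorem eq_of_emptyOn {M : Matroid ℕ} [M.Finite] (h : M.E = ∅) :
    of M = of (Matroid.emptyOn ℕ) := by
  obtain rfl := Matroid.ground_eq_empty_iff.1 h
  rfl

theorem exists_mul_eq_iff {c : MatroidClass} :
    (∃ p ∈ irreducibles ×ˢ (Set.univ : Set MatroidClass), mul p.1 p.2 = c) ↔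
      c ≠ of (Matroid.emptyOn ℕ) := by
  constructor
  · rintro ⟨⟨c, d⟩, ⟨hc, -⟩, rfl⟩ he
    obtain ⟨P, Q, _, _, h, rfl, rfl⟩ := exists_disjoint c d
    simp only [mul_of _ _ h] at he
    obtain ⟨x, hx⟩ := (of_mem_irreducibles.1 hc).1
    obtain ⟨e, -⟩ := of_eq_of_iff.1 he
    exact (e ⟨x, Or.inl hx⟩).2
  · intro hc
    obtain ⟨M, _, rfl⟩ := exists_of c
    obtain ⟨c, hc, d, hd⟩ := exists_mul_eq M (Set.nonempty_iff_ne_empty.2 fun h =>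
      hc (eq_of_emptyOn h))
    exact ⟨(c, d), ⟨hc, trivial⟩, hd⟩

/-- For a grading of the isomorphism classes that is additive on free products, the numbers of
matroids and of irreducible matroids satisfy the convolution recurrence. -/
theorem ncard_fiber_eq {G : Type*} [AddCommMonoid G] [DecidableEq G]
    [Finset.HasAntidiagonal G] (g : MatroidClass → G)
    (hfin : ∀ n, {c | g c = n}.Finite) (hmul : ∀ c d, g (mul c d) = g c + g d)
    (h0 : g (of (Matroid.emptyOn ℕ)) = 0) (n : G) :
    {c | g c = n}.ncard = (if n = 0 then 1 else 0) + ∑ p ∈ Finset.HasAntidiagonal.antidiagonal n,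
      {c | c ∈ irreducibles ∧ g c = p.1}.ncard * {c | g c = p.2}.ncard := by
  classical
  have hfin' : ∀ n, {c | c ∈ irreducibles ∧ g c = n}.Finite := fun n =>
    (hfin n).subset fun c hc => hc.2
  -- The pairs in `T` are counted by the convolution sum; multiplication maps them bijectively onto
  -- the classes of degree `n` other than the empty one.
  set T : Set (MatroidClass × MatroidClass) :=
    {p | p.1 ∈ irreducibles ∧ g p.1 + g p.2 = n} with hT
  have hTU : T = ⋃ p ∈ Finset.HasAntidiagonal.antidiagonal n,
      {c | c ∈ irreducibles ∧ g c = p.1} ×ˢ {c | g c = p.2} := by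
    ext ⟨c, d⟩
    simp only [hT, Set.mem_ofPred_eq, Set.mem_iUnion, Set.mem_prod,
      Finset.HasAntidiagonal.mem_antidiagonal,
      Prod.exists]
    constructor
    · rintro ⟨hc, he⟩
      exact ⟨g c, g d, he, ⟨hc, rfl⟩, rfl⟩
    · rintro ⟨a, b, he, ⟨hc, rfl⟩, rfl⟩
      exact ⟨hc, he⟩
  have hTcard : T.ncard = ∑ p ∈ Finset.HasAntidiagonal.antidiagonal n,
      {c | c ∈ irreducibles ∧ g c = p.1}.ncard * {c | g c = p.2}.ncard := by
    have hU := (Finset.finite_toSet (Finset.HasAntidiagonal.antidiagonal n)).ncard_biUnion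
      (s := fun p => {c | c ∈ irreducibles ∧ g c = p.1} ×ˢ {c | g c = p.2}) ?_ ?_
    · rw [finsum_mem_coe_finset] at hU
      rw [hTU]
      exact hU.trans (Finset.sum_congr rfl fun p _ => Set.ncard_prod)
    · exact fun p _ => (hfin' p.1).prod (hfin p.2)
    · rintro p - q - hpq
      refine Set.disjoint_left.2 ?_
      rintro ⟨c, d⟩ ⟨⟨-, h1⟩, h2⟩ ⟨⟨-, h3⟩, h4⟩
      exact hpq (Prod.ext (h1.symm.trans h3) (h2.symm.trans h4))
  have himg : (fun p : MatroidClass × MatroidClass => mul p.1 p.2) '' T =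
      {c | g c = n} \ {of (Matroid.emptyOn ℕ)} := by
    ext c
    constructor
    · rintro ⟨p, ⟨hp, he⟩, rfl⟩
      exact ⟨(hmul _ _).trans he, exists_mul_eq_iff.1 ⟨p, ⟨hp, trivial⟩, rfl⟩⟩
    · rintro ⟨hc : g c = n, hne⟩
      obtain ⟨p, ⟨hp, -⟩, rfl⟩ := exists_mul_eq_iff.2 hne
      exact Set.mem_image_of_mem _ (show p ∈ T from ⟨hp, (hmul p.1 p.2).symm.trans hc⟩)
  have hinj : Set.InjOn (fun p : MatroidClass × MatroidClass => mul p.1 p.2) T :=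
    mul_injOn.mono fun p hp => Set.mem_prod.2 ⟨hp.1, Set.mem_univ _⟩
  rw [← hTcard, ← hinj.ncard_image, himg]
  -- The empty class has degree zero, so its removal matters only for `n = 0`.
  split_ifs with hn
  · have hmem : of (Matroid.emptyOn ℕ) ∈ {c | g c = n} := h0.trans hn.symm
    rw [add_comm, Set.ncard_sdiff_singleton_add_one hmem (hfin n)]
  · rw [zero_add, Set.sdiff_singleton_eq_self fun h => hn (h.symm.trans h0)]

theorem ncard_irreducibles_zero {G : Type*} [AddCommMonoid G] (g : MatroidClass → G)
    (hfin : ∀ n, {c | g c = n}.Finite)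
    (h0 : ∀ c, g c = 0 → c = of (Matroid.emptyOn ℕ)) :
    {c | c ∈ irreducibles ∧ g c = 0}.ncard = 0 := by
  rw [Set.ncard_eq_zero ((hfin 0).subset fun c hc => hc.2), Set.eq_empty_iff_forall_notMem]
  rintro c ⟨hc, hg⟩
  rw [h0 c hg] at hc
  exact of_emptyOn_notMem_irreducibles hc

/-! ### The gradings by size and by rank and nullity -/

theorem ncard_ground_congr {M N : Matroid ℕ} [M.Finite] (h : IsIso M N) :
    M.E.ncard = N.E.ncard := by
  obtain ⟨σ, rfl⟩ := isIso_iff_exists_perm.1 h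
  exact (Set.ncard_image_of_injective _ σ.injective).symm

theorem rk_ground_congr {M N : Matroid ℕ} [M.Finite] (h : IsIso M N) : rk M M.E = rk N N.E := by
  obtain ⟨σ, rfl⟩ := isIso_iff_exists_perm.1 h
  exact (rk_mapEquiv M σ M.E).symm

theorem nullity_ground_congr {M N : Matroid ℕ} [M.Finite] (h : IsIso M N) :
    nullity M M.E = nullity N N.E := by
  rw [nullity, nullity, ncard_ground_congr h, rk_ground_congr h]

/-- The number of elements of the matroids in an isomorphism class. -/
noncomputable def size : MatroidClass → ℕ :=
  Quotient.lift (fun M => M.1.E.ncard) fun M _ h =>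
    have := M.2
    ncard_ground_congr h

/-- The rank and the nullity of the matroids in an isomorphism class, as an exponent. -/
noncomputable def rankNullity : MatroidClass → Fin 2 →₀ ℕ :=
  Quotient.lift (fun M => Finsupp.equivFunOnFinite.symm ![rk M.1 M.1.E, nullity M.1 M.1.E])
    fun M _ h => by
      have := M.2
      rw [rk_ground_congr h, nullity_ground_congr h]

theorem size_of (M : Matroid ℕ) [M.Finite] : size (of M) = M.E.ncard := rfl

theorem rankNullity_of (M : Matroid ℕ) [M.Finite] : rankNullity (of M) =
    Finsupp.equivFunOnFinite.symm ![rk M M.E, nullity M M.E] := rfl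

theorem rankNullity_of_eq_iff {M : Matroid ℕ} [M.Finite] {s : Fin 2 →₀ ℕ} :
    rankNullity (of M) = s ↔ rk M M.E = s 0 ∧ nullity M M.E = s 1 := by
  rw [rankNullity_of, Finsupp.ext_iff, Fin.forall_fin_two]
  rfl

theorem isoClasses_eq (P : Matroid ℕ → Prop) (S : Set MatroidClass)
    (h : ∀ (M : Matroid ℕ) [M.Finite], of M ∈ S ↔ P M) : isoClasses P = S := by
  ext c
  constructor
  · rintro ⟨M, rfl, hM⟩
    have := M.2
    exact (h M.1).2 hM
  · intro hc
    obtain ⟨M, hM, rfl⟩ := exists_of c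
    exact ⟨⟨M, hM⟩, rfl, (h M).1 hc⟩

theorem isoClasses_size (n : ℕ) : (isoClasses fun M => M.E.ncard = n) = {c | size c = n} :=
  isoClasses_eq _ _ fun _ _ => Iff.rfl

theorem isoClasses_rankNullity (s : Fin 2 →₀ ℕ) :
    (isoClasses fun M => rk M M.E = s 0 ∧ nullity M M.E = s 1) = {c | rankNullity c = s} :=
  isoClasses_eq _ _ fun _ _ => rankNullity_of_eq_iff

theorem isoClasses_irreducible_size (n : ℕ) :
    (isoClasses fun M => IsIrreducible M ∧ M.E.ncard = n) =
      {c | c ∈ irreducibles ∧ size c = n} :=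
  isoClasses_eq _ _ fun _ _ => and_congr of_mem_irreducibles Iff.rfl

theorem isoClasses_irreducible_rankNullity (s : Fin 2 →₀ ℕ) :
    (isoClasses fun M => IsIrreducible M ∧ rk M M.E = s 0 ∧ nullity M M.E = s 1) =
      {c | c ∈ irreducibles ∧ rankNullity c = s} :=
  isoClasses_eq _ _ fun _ _ => and_congr of_mem_irreducibles rankNullity_of_eq_iff

theorem size_mul (c d : MatroidClass) : size (mul c d) = size c + size d := by
  obtain ⟨P, Q, _, _, h, rfl, rfl⟩ := exists_disjoint c d
  rw [mul_of P Q h, size_of, size_of, size_of, ncard_ground_freeProduct]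

theorem rankNullity_mul (c d : MatroidClass) :
    rankNullity (mul c d) = rankNullity c + rankNullity d := by
  obtain ⟨P, Q, _, _, h, rfl, rfl⟩ := exists_disjoint c d
  rw [mul_of P Q h, rankNullity_of_eq_iff, freeProduct_ground, rk_freeProduct,
    nullity_freeProduct]
  exact ⟨rfl, rfl⟩

theorem size_emptyOn : size (of (Matroid.emptyOn ℕ)) = 0 := by
  rw [size_of, Matroid.emptyOn_ground, Set.ncard_empty]

theorem rankNullity_emptyOn : rankNullity (of (Matroid.emptyOn ℕ)) = 0 := by
  rw [rankNullity_of_eq_iff]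
  simp [nullity, rk]

theorem eq_emptyOn_of_size_eq_zero (c : MatroidClass) (h : size c = 0) :
    c = of (Matroid.emptyOn ℕ) := by
  obtain ⟨M, _, rfl⟩ := exists_of c
  rw [size_of, Set.ncard_eq_zero M.ground_finite] at h
  exact eq_of_emptyOn h

theorem eq_emptyOn_of_rankNullity_eq_zero (c : MatroidClass) (h : rankNullity c = 0) :
    c = of (Matroid.emptyOn ℕ) := by
  obtain ⟨M, _, rfl⟩ := exists_of c
  rw [rankNullity_of_eq_iff] at h
  refine eq_emptyOn_of_size_eq_zero _ ?_
  obtain ⟨h1, h2⟩ := h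
  rw [Finsupp.coe_zero, Pi.zero_apply] at h1 h2
  -- As the rank is zero, the truncated difference is the cardinality itself.
  rw [nullity] at h2
  rw [size_of]
  omega

theorem finite_size (n : ℕ) : {c | size c = n}.Finite :=
  isoClasses_size n ▸ finite_isoClasses_size n

theorem finite_rankNullity (s : Fin 2 →₀ ℕ) : {c | rankNullity c = s}.Finite :=
  isoClasses_rankNullity s ▸ finite_isoClasses_rank_nullity (s 0) (s 1)

end MatroidClass

/-! ### The power series identities -/

open MatroidClass

theorem constantCoeff_irreducibleSeries :
    PowerSeries.constantCoeff irreducibleSeries = 0 := by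
  rw [← PowerSeries.coeff_zero_eq_constantCoeff_apply, irreducibleSeries, PowerSeries.coeff_mk,
    numIrreducibles, isoClasses_irreducible_size,
    ncard_irreducibles_zero size finite_size eq_emptyOn_of_size_eq_zero, Nat.cast_zero]

theorem matroidSeries_eq : matroidSeries = 1 + irreducibleSeries * matroidSeries := by
  ext n
  simp only [matroidSeries, irreducibleSeries, map_add, PowerSeries.coeff_one,
    PowerSeries.coeff_mul, PowerSeries.coeff_mk, numMatroids, numIrreducibles, isoClasses_size,
    isoClasses_irreducible_size]
  rw [ncard_fiber_eq size finite_size size_mul size_emptyOn]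
  push_cast
  rfl

theorem coeff_irreducibleSeriesRN (s : Fin 2 →₀ ℕ) :
    MvPowerSeries.coeff s irreducibleSeriesRN =
      ({c | c ∈ irreducibles ∧ rankNullity c = s}.ncard : ℚ) := by
  rw [← isoClasses_irreducible_rankNullity]
  rfl

theorem coeff_matroidSeriesRN (s : Fin 2 →₀ ℕ) :
    MvPowerSeries.coeff s matroidSeriesRN = ({c | rankNullity c = s}.ncard : ℚ) := by
  rw [← isoClasses_rankNullity]
  rfl

theorem constantCoeff_irreducibleSeriesRN :
    MvPowerSeries.constantCoeff irreducibleSeriesRN = 0 := by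
  rw [← MvPowerSeries.coeff_zero_eq_constantCoeff_apply, coeff_irreducibleSeriesRN,
    ncard_irreducibles_zero rankNullity finite_rankNullity eq_emptyOn_of_rankNullity_eq_zero,
    Nat.cast_zero]

theorem matroidSeriesRN_eq : matroidSeriesRN = 1 + irreducibleSeriesRN * matroidSeriesRN := by
  ext s
  simp only [map_add, MvPowerSeries.coeff_one, MvPowerSeries.coeff_mul, coeff_matroidSeriesRN,
    coeff_irreducibleSeriesRN]
  rw [ncard_fiber_eq rankNullity finite_rankNullity rankNullity_mul rankNullity_emptyOn]
  push_cast
  rfl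

end FreeProd

theorem mainTheorem12 :
    (IsUnit (1 - FreeProd.irreducibleSeries) ∧
      FreeProd.matroidSeries = (1 - FreeProd.irreducibleSeries)⁻¹) ∧
    (IsUnit (1 - FreeProd.irreducibleSeriesRN) ∧
      FreeProd.matroidSeriesRN = (1 - FreeProd.irreducibleSeriesRN)⁻¹) := by
  have h1 : PowerSeries.constantCoeff (1 - FreeProd.irreducibleSeries) = 1 := by
    rw [map_sub, map_one, FreeProd.constantCoeff_irreducibleSeries, sub_zero]
  have h2 : MvPowerSeries.constantCoeff (1 - FreeProd.irreducibleSeriesRN) = 1 := by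
    rw [map_sub, map_one, FreeProd.constantCoeff_irreducibleSeriesRN, sub_zero]
  refine ⟨⟨?_, ?_⟩, ?_, ?_⟩
  · rw [PowerSeries.isUnit_iff_constantCoeff, h1]
    exact isUnit_one
  · rw [PowerSeries.eq_inv_iff_mul_eq_one (by rw [h1]; exact one_ne_zero)]
    linear_combination FreeProd.matroidSeries_eq
  · rw [MvPowerSeries.isUnit_iff_constantCoeff, h2]
    exact isUnit_one
  · rw [MvPowerSeries.eq_inv_iff_mul_eq_one (by rw [h2]; exact one_ne_zero)]
    linear_combination FreeProd.matroidSeriesRN_eq
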